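/- Let $S=\{s_1,\dots,s_r\}$ be a finite nonempty set and let $(W,S)$ be a Coxeter system, $$W=\langle S \mid (s_is_j)^{m_{ij}}=1\rangle,\qquad m_{ii}=1,\quad m_{ij}=m_{ji}\in\{2,3,\dots\}\cup\{\infty\}\ \ (i\ne j),$$ where $m_{ij}=\infty$ means that no relation is imposed on $s_is_j$. The divisibility diagram $\mathrm{Cox}_{\mathrm{div}}(W)$ has a vertex $v_i$ for each $s_i\in S$; for $i\neq j$, the vertices $v_i$ and $v_j$ are joined by an edge labelled by the least divisor of $m_{ij}$ greater than $1$ if $m_{ij}<\infty$, and are not joined (the edge is absent) if $m_{ij}=\infty$. An edge with label $3$ is called simple. A reflection is an element of $W$ conjugate to an element of $S$. If at most one edge of $\mathrm{Cox}_{\mathrm{div}}(W)$ is neither simple nor absent, then $W$ has a proper subgroup of finite index that is generated by reflections. -/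

import Mathlib

/-- The underlying graph of the divisibility diagram of a Coxeter matrix `M`: the vertices are the
indices of the generators, and two distinct vertices `i`, `j` are joined if and only if `m_ij` is
finite. (In Mathlib, `M i j = 0` encodes `m_ij = ∞`.) -/
def CoxeterMatrix.divGraph {B : Type*} (M : CoxeterMatrix B) : SimpleGraph B where
  Adj i j := i ≠ j ∧ M i j ≠ 0
  symm := ⟨fun i j h => ⟨h.1.symm, M.symmetric i j ▸ h.2⟩⟩
  loopless := ⟨fun _ h => h.1 rfl⟩

/-- The label of an edge `{i, j}` of the divisibility diagram: the least divisor of `m_ij` that is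
greater than `1`. (The value is only meaningful on edges of `M.divGraph`, where
`2 ≤ m_ij < ∞`.) -/
def CoxeterMatrix.divLabel {B : Type*} (M : CoxeterMatrix B) : Sym2 B → ℕ :=
  Sym2.lift ⟨fun i j => (M i j).minFac, fun i j => congrArg Nat.minFac (M.symmetric i j)⟩

/-- The multiple edges of the divisibility diagram: the edges whose label is not `3`, that is, the
pairs of vertices whose edge is neither simple (label `3`) nor absent. -/
def CoxeterMatrix.multipleEdges {B : Type*} (M : CoxeterMatrix B) : Set (Sym2 B) :=
  {e | e ∈ M.divGraph.edgeSet ∧ M.divLabel e ≠ 3}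

/-- A reflection subgroup of a Coxeter group: a proper subgroup generated by reflections, that is,
by conjugates of the generators. -/
def CoxeterSystem.IsReflectionSubgroup {B : Type*} {M : CoxeterMatrix B} {W : Type*} [Group W]
    (cs : CoxeterSystem M W) (V : Subgroup W) : Prop :=
  V ≠ ⊤ ∧ ∃ T : Set W, (∀ t ∈ T, cs.IsReflection t) ∧ Subgroup.closure T = V

namespace CoxeterSystem

variable {B : Type*} {M : CoxeterMatrix B} {W : Type*} [Group W]

/-! Merge the ends `a`, `b` of the one possibly bad edge and let each `s_i` act as a transposition
moving `none`; the product of two distinct ones has order 3, so the relations hold. Let `V` be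
generated by the reflections fixing `none`. It is proper, as `s_a` moves `none`. The cosets `rV` and
`s_j r V`, with `r` in the finite group `⟨s_a s_b⟩`, are permuted among themselves by left
multiplication by generators, so they exhaust `W ⧸ V`. -/

/-- If all finite `m_ij` are divisible by `3` whenever `f` separates `i` and `j`, then sending each
generator `s_i` to the transposition of `none` and `some (f i)` respects the Coxeter relations. -/
theorem isLiftable_swap_none [Finite B] [DecidableEq B] {f : B → B}
    (hf : ∀ i j, f i ≠ f j → 3 ∣ M i j) :
    M.IsLiftable fun i => Equiv.swap none (some (f i)) := by
  have := Fintype.ofFinite B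
  intro i j
  by_cases hij : f i = f j
  · simp [hij]
  · have h3 : (Equiv.swap none (some (f i)) * Equiv.swap none (some (f j))) ^ 3 = 1 := by
      have := (Equiv.Perm.isThreeCycle_swap_mul_swap_same (a := (none : Option B))
        (b := some (f i)) (c := some (f j)) (by simp) (by simp) (by simpa using hij)).orderOf
      rw [← this, pow_orderOf_eq_one]
    obtain ⟨k, hk⟩ := hf i j hij
    rw [hk, pow_mul, h3, one_pow]

/-- If `s_a s_b` has finite order and every other pair of distinct generators has `m_ij = ∞` or
`3 ∣ m_ij`, then some proper subgroup of finite index is generated by reflections. -/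
theorem exists_isReflectionSubgroup_finiteIndex [Finite B] (cs : CoxeterSystem M W) (a b : B)
    (hab : M a b ≠ 0) (h : ∀ i j, i ≠ j → s(i, j) ≠ s(a, b) → 3 ∣ M i j) :
    ∃ V : Subgroup W, cs.IsReflectionSubgroup V ∧ V.FiniteIndex := by
  classical
  let f : B → B := fun i => if i = b then a else i
  have hfab : f a = f b := by simp [f]
  have hf : ∀ i j, f i = f j → i ≠ j → s(i, j) = s(a, b) := by
    intro i j hij hne
    simp only [f] at hij
    rw [Sym2.eq_iff]
    split_ifs at hij <;> grind
  have hlift := isLiftable_swap_none (M := M) (f := f) fun i j hij =>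
    h i j (fun e => hij (e ▸ rfl)) fun e => hij <| by
      rcases Sym2.eq_iff.1 e with ⟨rfl, rfl⟩ | ⟨rfl, rfl⟩
      · exact hfab
      · exact hfab.symm
  let φ : W →* Equiv.Perm (Option B) := cs.lift ⟨_, hlift⟩
  have hφ : ∀ i, φ (cs.simple i) = Equiv.swap none (some (f i)) := cs.lift_apply_simple hlift
  let T : Set W := {t | cs.IsReflection t ∧ φ t none = none}
  let V := Subgroup.closure T
  let R := Subgroup.zpowers (cs.simple a * cs.simple b)
  have hR : ∀ r ∈ R, φ r = 1 := by
    have : R ≤ φ.ker := by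
      rw [Subgroup.zpowers_le, MonoidHom.mem_ker, map_mul, hφ, hφ, hfab, Equiv.swap_mul_self]
    exact this
  have hRij : ∀ i j, f i = f j → cs.simple i * cs.simple j ∈ R := by
    intro i j hij
    by_cases hne : i = j
    · simp [hne, R.one_mem]
    · rcases Sym2.eq_iff.1 (hf i j hij hne) with ⟨rfl, rfl⟩ | ⟨rfl, rfl⟩
      · exact Subgroup.mem_zpowers _
      · simpa using R.inv_mem (Subgroup.mem_zpowers (cs.simple j * cs.simple i))
  have : Finite R := by
    refine finite_zpowers.2 <| isOfFinOrder_iff_pow_eq_one.2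
      ⟨M a b, Nat.pos_of_ne_zero hab, cs.simple_mul_simple_pow a b⟩
  refine ⟨V, ⟨fun htop => ?_, T, fun t ht => ht.1, rfl⟩, ?_⟩
  · have hle : V ≤ (MulAction.stabilizer (Equiv.Perm (Option B)) (none : Option B)).comap φ := by
      rw [Subgroup.closure_le]
      exact fun t ht => ht.2
    have hmem : φ (cs.simple a) none = none := hle (htop ▸ Subgroup.mem_top (cs.simple a))
    rw [hφ, Equiv.swap_apply_left] at hmem
    exact Option.some_ne_none _ hmem
  · let F : R ⊕ B × R → W ⧸ V :=
      Sum.elim (fun r => (r : W)) fun p => (cs.simple p.1 * p.2 : W)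
    have hmul : ∀ {x y : W} (g : W), (x : W ⧸ V) = y → ((g * x : W) : W ⧸ V) = (g * y : W) := by
      intro x y g hxy
      rw [QuotientGroup.eq] at hxy ⊢
      simpa [mul_assoc] using hxy
    have hF : ∀ w : W, (w : W ⧸ V) ∈ Set.range F := by
      intro w
      induction w using cs.simple_induction_left with
      | one => exact ⟨.inl 1, rfl⟩
      | mul_simple_left w i ih =>
        obtain ⟨r | ⟨j, r⟩, hr⟩ := ih
        · refine ⟨.inr (i, r), ?_⟩
          exact hmul _ hr
        · have hw := hmul (cs.simple i) hr
          by_cases hij : f i = f j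
          · refine ⟨.inl ⟨_, R.mul_mem (hRij i j hij) r.2⟩, ?_⟩
            rw [← hw, ← mul_assoc]
            rfl
          · refine ⟨.inr (j, r), ?_⟩
            rw [← hw]
            -- Here `s_i` fixes the coset `s_j r V`: conjugating `s_i` by `s_j r` gives a reflection
            -- acting as the transposition of `some (f i)` and `some (f j)`, which fixes `none`.
            refine QuotientGroup.eq.2 (Subgroup.subset_closure ⟨?_, ?_⟩)
            · refine ⟨(cs.simple j * r : W)⁻¹, i, ?_⟩
              group
            · simp [hR r r.2, hφ, Equiv.swap_apply_of_ne_of_ne, Ne.symm hij]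
    have : Finite (W ⧸ V) :=
      Finite.of_surjective F fun q => QuotientGroup.induction_on q hF
    exact Subgroup.finiteIndex_of_finite_quotient

end CoxeterSystem

theorem lemma4p2 {B : Type*} [Finite B] [Nonempty B] {M : CoxeterMatrix B}
    {W : Type*} [Group W] (cs : CoxeterSystem M W)
    (h : M.multipleEdges.encard ≤ 1) :
    ∃ V : Subgroup W, cs.IsReflectionSubgroup V ∧ V.FiniteIndex := by
  have key : ∀ i j, i ≠ j → s(i, j) ∉ M.multipleEdges → 3 ∣ M i j := by
    intro i j hij hnot
    by_contra h3
    refine hnot ⟨(SimpleGraph.mem_edgeSet _).2 ⟨hij, fun h0 => h3 (h0 ▸ dvd_zero 3)⟩, fun hl => ?_⟩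
    change (M i j).minFac = 3 at hl
    exact h3 (hl ▸ Nat.minFac_dvd _)
  rcases Set.eq_empty_or_nonempty M.multipleEdges with he | ⟨e, he⟩
  · obtain ⟨a⟩ := ‹Nonempty B›
    -- With no bad edge nothing needs merging: `a = b` makes `f` the identity and `R` trivial.
    exact cs.exists_isReflectionSubgroup_finiteIndex a a (by simp) fun i j hij _ =>
      key i j hij (by simp [he])
  · induction e using Sym2.ind with
    | _ a b =>
      exact cs.exists_isReflectionSubgroup_finiteIndex a b ((SimpleGraph.mem_edgeSet _).1 he.1).2
        fun i j hij hne => key i j hij fun hmem => hne (Set.encard_le_one_iff.1 h _ _ hmem he)
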